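/- Let $D$ be an integral domain with quotient field $K$. For a nonzero $D$-submodule $E$ of $K$ put $E^{-1}=\{x\in K : xE\subseteq D\}$, $E^v=(E^{-1})^{-1}$ and $E^t=\bigcup\{F^v : F\subseteq E,\ F \text{ a nonzero finitely generated } D\text{-submodule}\}$. A nonzero ideal $I$ of $D$ is a $t$-ideal if $I=I^t$, divisorial if $I=I^v$, and $t$-idempotent if $I^t=(I^2)^t$. A $t$-prime is a prime ideal that is a (nonzero) $t$-ideal, and a $t$-maximal ideal is a maximal element of the set of proper $t$-ideals. An ideal $I$ is a $t$-product of ideals $P_1,\dots,P_n$ ($n\ge 0$, the empty product being $D$) if $I=(P_1\cdots P_n)^t$. The domain $D$ is a P$v$MD (Prüfer $v$-multiplication domain) if $(FF^{-1})^t=D$ for every nonzero finitely generated $D$-submodule $F$ of $K$, and it has finite $t$-character if every nonzero element of $D$ lies in only finitely many $t$-maximal ideals. Let $D$ be a P$v$MD of finite $t$-character, and let $I$ be a nonzero $t$-ideal of $D$. Then: 1. $I$ is $t$-idempotent if and only if $I$ is a $t$-product of $t$-idempotent $t$-primes of $D$. 2. The following statements are equivalent: (a) $I$ is $t$-idempotent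 and divisorial. (b) $I$ is a $t$-product of non-$t$-maximal $t$-idempotent $t$-primes. (c) $I$ is a $t$-product of divisorial $t$-idempotent $t$-primes. (d) $I$ has a unique (up to the order of the factors) representation as a $t$-product of pairwise incomparable divisorial $t$-idempotent $t$-primes. -/

import Mathlib

/-! The `v`- and `t`-operations on a domain `D` with quotient field `K` (the definitions are only
used under `[IsDomain D]` and `[IsFractionRing D K]`).
Fractional ideals are treated as `D`-submodules of `K`; `1 : Submodule D K` is the image of `D`,
and `1 / E` is `E⁻¹ = {x ∈ K | x E ⊆ D}`. -/

namespace StarOp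

variable (D : Type*) (K : Type*) [CommRing D] [Field K] [Algebra D K]

variable {D K} in
/-- The `v`-closure `E^v = (E⁻¹)⁻¹`. -/
def vClosure (E : Submodule D K) : Submodule D K := 1 / (1 / E)

variable {D K} in
theorem vClosure_mono {E F : Submodule D K} (h : E ≤ F) : vClosure E ≤ vClosure F := by
  intro x hx
  rw [vClosure, Submodule.mem_div_iff_forall_mul_mem] at hx ⊢
  intro y hy
  refine hx y ?_
  rw [Submodule.mem_div_iff_forall_mul_mem] at hy ⊢
  exact fun z hz => hy z (h hz)

variable {D K} in
/-- The `t`-closure `E^t = ⋃ {F^v | F ⊆ E finitely generated}`. For `E ≠ 0` it makes no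
difference whether `F = 0` is allowed. -/
def tClosure (E : Submodule D K) : Submodule D K where
  carrier := {x | ∃ F : Submodule D K, F.FG ∧ F ≤ E ∧ x ∈ vClosure F}
  zero_mem' := ⟨⊥, Submodule.fg_bot, bot_le, Submodule.zero_mem _⟩
  add_mem' := by
    rintro x y ⟨F, hF, hFE, hx⟩ ⟨G, hG, hGE, hy⟩
    exact ⟨F ⊔ G, hF.sup hG, sup_le hFE hGE,
      Submodule.add_mem _ (vClosure_mono le_sup_left hx) (vClosure_mono le_sup_right hy)⟩
  smul_mem' := by
    rintro c x ⟨F, hF, hFE, hx⟩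
    exact ⟨F, hF, hFE, Submodule.smul_mem _ c hx⟩

variable {D} in
/-- An ideal of `D`, viewed as a `D`-submodule of `K`. -/
abbrev toK (I : Ideal D) : Submodule D K := IsLocalization.coeSubmodule K I

variable {D} in
/-- `I` is a (nonzero) `t`-ideal: `I = I^t`. -/
def IsTIdeal (I : Ideal D) : Prop := I ≠ ⊥ ∧ tClosure (toK K I) = toK K I

variable {D} in
/-- `P` is a `t`-prime: a prime `t`-ideal. -/
def IsTPrime (P : Ideal D) : Prop := P.IsPrime ∧ IsTIdeal K P

variable {D} in
/-- `M` is `t`-maximal: maximal among the proper `t`-ideals. -/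
def IsTMaximal (M : Ideal D) : Prop := Maximal (fun J : Ideal D => J ≠ ⊤ ∧ IsTIdeal K J) M

variable {D} in
/-- `I` is divisorial: `I = I^v`. -/
def IsDivisorial (I : Ideal D) : Prop := vClosure (toK K I) = toK K I

variable {D} in
/-- `I` is `t`-idempotent: `I^t = (I²)^t`. -/
def IsTIdempotent (I : Ideal D) : Prop := tClosure (toK K I) = tClosure (toK K (I ^ 2))

/-- `D` is a Prüfer `v`-multiplication domain: every nonzero finitely generated `D`-submodule
`F` of `K` is `t`-invertible, `(F F⁻¹)^t = D`. -/
def IsPvMD : Prop :=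
  ∀ F : Submodule D K, F ≠ ⊥ → F.FG → tClosure (F * (1 / F)) = 1

/-- `D` has finite `t`-character: every nonzero element of `D` lies in only finitely many
`t`-maximal ideals. -/
def HasFiniteTCharacter : Prop :=
  ∀ x : D, x ≠ 0 → {M : Ideal D | IsTMaximal K M ∧ x ∈ M}.Finite

variable {D} in
/-- `I` is the `t`-product of the ideals in `s` (counted with multiplicity):
`I = (P₁ ⋯ Pₙ)^t`. The empty product is `D`. -/
def IsTProduct (I : Ideal D) (s : Multiset (Ideal D)) : Prop :=
  toK K I = tClosure (toK K s.prod)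

variable {D} in
/-- The ideals in `s` are pairwise incomparable (in particular none is repeated). -/
def Incomparable (s : Multiset (Ideal D)) : Prop :=
  s.Nodup ∧ ∀ P ∈ s, ∀ Q ∈ s, P ≠ Q → ¬ P ≤ Q

end StarOp

/-!
In a P`v`MD the localizations at the `t`-primes are valuation domains, and `t`-closures can be
computed locally at the `t`-maximal ideals `M`, where the `t`-operation is trivial. A proper
idempotent ideal of a valuation domain is prime; hence a `t`-idempotent `t`-ideal `I` is the
intersection of the `t`-primes `I D_M ∩ D`, and finite `t`-character makes this a finite
intersection. The primes contained in `M` form a chain, so at most one of several incomparable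
`t`-primes survives in `D_M`, and their `t`-product is their intersection.

If a `t`-maximal ideal `M` is `t`-idempotent, then `M⁻¹ M ⊆ (M⁻¹ M²)^t ⊆ M^t = M`, and since `D_M`
is a valuation domain this forces `M⁻¹ = D`; so `M` could be dropped from any `t`-product that is
divisorial. Conversely let `P` be a `t`-prime that is not `t`-maximal, and choose `a ∉ P` in all of
the finitely many `t`-maximal ideals `M` above `P`. For every `b ∉ P` there is a finitely generated
ideal `J` with `P ⊆ J^t` and `J D_M = b D_M`, so that `P^v ⊆ J^v ⊆ b D_M`. An element
`d ∈ P^v` outside `P` would therefore lie in `a d D_M`, although `a` is not a unit of `D_M`.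
-/

namespace StarOp

section Saturation

variable {R : Type*} [CommRing R] {N N' : Type*} [AddCommGroup N] [Module R N]
  [AddCommGroup N'] [Module R N']

/-- The `S`-saturation `{x | ∃ s ∈ S, s • x ∈ E}` of a submodule. With `S` the complement of a
prime `M` of `D`, the saturation of a submodule `E` of `K` is the localization `E_M ⊆ K`, and that
of an ideal `I` of `D` is the contraction `I D_M ∩ D`. -/
def saturation (S : Submonoid R) (E : Submodule R N) : Submodule R N :=
  (Submodule.torsion' R (N ⧸ E) S).comap E.mkQ

variable {S T : Submonoid R} {E F : Submodule R N} {x y : N}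

theorem mem_saturation : x ∈ saturation S E ↔ ∃ s ∈ S, s • x ∈ E := by
  simp only [saturation, Submodule.mem_comap, Submodule.mkQ_apply, Submodule.mem_torsion'_iff,
    Subtype.exists, Submonoid.mk_smul, ← Submodule.Quotient.mk_smul,
    Submodule.Quotient.mk_eq_zero, exists_prop]

theorem le_saturation (S : Submonoid R) (E : Submodule R N) : E ≤ saturation S E :=
  fun x hx => mem_saturation.2 ⟨1, S.one_mem, by rwa [one_smul]⟩

theorem saturation_le_saturation (h : E ≤ saturation S F) : saturation S E ≤ saturation S F := by
  intro x hx
  obtain ⟨s, hs, hx⟩ := mem_saturation.1 hx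
  obtain ⟨t, ht, hx⟩ := mem_saturation.1 (h hx)
  exact mem_saturation.2 ⟨t * s, S.mul_mem ht hs, by rwa [mul_smul]⟩

theorem saturation_mono (h : E ≤ F) : saturation S E ≤ saturation S F :=
  saturation_le_saturation (h.trans (le_saturation S F))

theorem saturation_mono_left (h : S ≤ T) (E : Submodule R N) :
    saturation S E ≤ saturation T E := fun _ hx =>
  let ⟨s, hs, hx⟩ := mem_saturation.1 hx
  mem_saturation.2 ⟨s, h hs, hx⟩

theorem comap_saturation (f : N →ₗ[R] N') (S : Submonoid R) (G : Submodule R N') :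
    (saturation S G).comap f = saturation S (G.comap f) := by
  ext
  simp only [Submodule.mem_comap, mem_saturation, map_smul]

theorem exists_smul_mem_of_fg (hF : F.FG) (h : F ≤ saturation S E) :
    ∃ s ∈ S, ∀ x ∈ F, s • x ∈ E := by
  induction F, hF using Submodule.fg_induction with
  | singleton x =>
    obtain ⟨s, hs, hx⟩ := mem_saturation.1 (h (Submodule.mem_span_singleton_self x))
    exact ⟨s, hs, (Submodule.span_singleton_le_iff_mem x (E.comap (LinearMap.lsmul R N s))).2 hx⟩
  | sup F₁ F₂ _ _ ih₁ ih₂ =>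
    obtain ⟨s, hs, h₁⟩ := ih₁ (le_sup_left.trans h)
    obtain ⟨t, ht, h₂⟩ := ih₂ (le_sup_right.trans h)
    refine ⟨s * t, S.mul_mem hs ht, show F₁ ⊔ F₂ ≤ E.comap (LinearMap.lsmul R N (s * t)) from
      sup_le (fun x hx => ?_) fun x hx => ?_⟩
    · change (s * t) • x ∈ E
      rw [mul_comm, mul_smul]
      exact E.smul_mem t (h₁ x hx)
    · change (s * t) • x ∈ E
      rw [mul_smul]
      exact E.smul_mem s (h₂ x hx)

/-- `S⁻¹N` is uniserial, i.e. its `S⁻¹R`-submodules form a chain. For a domain `R` and `N` equal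
to `R` or to its quotient field, this says that `S⁻¹R` is a valuation ring. -/
def IsUniserialAt (S : Submonoid R) (N : Type*) [AddCommGroup N] [Module R N] : Prop :=
  ∀ x y : N, x ∈ saturation S (R ∙ y) ∨ y ∈ saturation S (R ∙ x)

theorem IsUniserialAt.of_injective (h : IsUniserialAt S N') {f : N →ₗ[R] N'}
    (hf : Function.Injective f) : IsUniserialAt S N := by
  have hspan (y : N) : saturation S (R ∙ y) = (saturation S (R ∙ f y)).comap f := by
    rw [comap_saturation, ← Set.image_singleton, ← Submodule.map_span,
      Submodule.comap_map_eq_of_injective hf]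
  intro x y
  simpa only [hspan, Submodule.mem_comap] using h (f x) (f y)

theorem IsUniserialAt.le_saturation_span_of_notMem (h : IsUniserialAt S N)
    (hx : x ∉ saturation S E) : E ≤ saturation S (R ∙ x) := fun y hy =>
  (h y x).resolve_right fun hxy =>
    hx (saturation_mono ((Submodule.span_singleton_le_iff_mem y E).2 hy) hxy)

theorem IsUniserialAt.exists_mem_le_saturation_span (h : IsUniserialAt S N) (hF : F.FG) :
    ∃ a ∈ F, F ≤ saturation S (R ∙ a) := by
  induction F, hF using Submodule.fg_induction with
  | singleton x => exact ⟨x, Submodule.mem_span_singleton_self x, le_saturation S _⟩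
  | sup F₁ F₂ _ _ ih₁ ih₂ =>
    obtain ⟨a, ha, h₁⟩ := ih₁
    obtain ⟨b, hb, h₂⟩ := ih₂
    rcases h a b with hab | hab <;>
      replace hab := saturation_le_saturation ((Submodule.span_singleton_le_iff_mem _ _).2 hab)
    · exact ⟨b, Submodule.mem_sup_right hb, sup_le (h₁.trans hab) h₂⟩
    · exact ⟨a, Submodule.mem_sup_left ha, sup_le h₁ (h₂.trans hab)⟩

end Saturation

section SaturationIdeal

variable {R : Type*} [CommRing R] {S : Submonoid R} {I J P Q : Ideal R}

theorem saturation_mul_saturation_le (S : Submonoid R) (I J : Ideal R) :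
    saturation S I * saturation S J ≤ saturation S (I * J) := by
  refine Ideal.mul_le.2 fun x hx y hy => ?_
  obtain ⟨s, hs, hx⟩ := mem_saturation.1 hx
  obtain ⟨t, ht, hy⟩ := mem_saturation.1 hy
  exact mem_saturation.2 ⟨s * t, S.mul_mem hs ht,
    smul_mul_smul_comm s x t y ▸ Ideal.mul_mem_mul hx hy⟩

theorem primeCompl_le_primeCompl [P.IsPrime] [Q.IsPrime] (h : P ≤ Q) :
    Q.primeCompl ≤ P.primeCompl := fun _ hx hxP => hx (h hxP)

theorem saturation_le_of_isPrime [hQ : Q.IsPrime] (hS : S ≤ Q.primeCompl) (h : I ≤ Q) :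
    saturation S I ≤ Q := by
  intro x hx
  obtain ⟨s, hs, hx⟩ := mem_saturation.1 hx
  exact (hQ.mem_or_mem (h hx)).resolve_left (hS hs)

theorem saturation_primeCompl_eq_top [Q.IsPrime] (h : ¬ I ≤ Q) :
    saturation Q.primeCompl I = ⊤ := by
  obtain ⟨a, haI, haQ⟩ := SetLike.not_le_iff_exists.1 h
  exact (Ideal.eq_top_iff_one _).2 (mem_saturation.2 ⟨a, haQ, by simpa using haI⟩)

theorem IsUniserialAt.le_saturation_span_of_isPrime (h : IsUniserialAt S R) [P.IsPrime]
    (hS : S ≤ P.primeCompl) {b : R} (hb : b ∉ P) : P ≤ saturation S (Ideal.span {b}) :=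
  h.le_saturation_span_of_notMem fun hbP => hb (saturation_le_of_isPrime hS le_rfl hbP)

theorem IsUniserialAt.le_or_le_of_isPrime (h : IsUniserialAt S R) [P.IsPrime] [Q.IsPrime]
    (hP : S ≤ P.primeCompl) (hQ : S ≤ Q.primeCompl) : P ≤ Q ∨ Q ≤ P := by
  refine or_iff_not_imp_left.2 fun hPQ => ?_
  obtain ⟨a, haP, haQ⟩ := SetLike.not_le_iff_exists.1 hPQ
  exact (h.le_saturation_span_of_isPrime hQ haQ).trans
    (saturation_le_of_isPrime hP ((Ideal.span_singleton_le_iff_mem P).2 haP))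

/-- A prime `Q` of a valuation ring `V` satisfies `Q = t Q` for `t ∉ Q`, so it absorbs the
denominators outside `Q`. -/
theorem IsUniserialAt.saturation_primeCompl_mul_le [IsDomain R] (h : IsUniserialAt S R)
    [hQ : Q.IsPrime] (hS : S ≤ Q.primeCompl) (L : Ideal R) :
    saturation Q.primeCompl (Q * L) ≤ saturation S (Q * L) := by
  intro x hx
  obtain ⟨t, ht, hx⟩ := mem_saturation.1 hx
  have hQt : Q ≤ saturation S (Ideal.span {t} * Q) := by
    intro q hq
    obtain ⟨s, hs, hsq⟩ := mem_saturation.1 (h.le_saturation_span_of_isPrime hS ht hq)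
    obtain ⟨d, hd⟩ := Ideal.mem_span_singleton.1 hsq
    have hdQ : d ∈ Q := (hQ.mem_or_mem (hd ▸ Q.mul_mem_left s hq)).resolve_left ht
    exact mem_saturation.2 ⟨s, hs, hd ▸ Ideal.mul_mem_mul (Ideal.mem_span_singleton_self t) hdQ⟩
  have htx : t * x ∈ saturation S (Ideal.span {t} * (Q * L)) := by
    rw [← mul_assoc]
    exact saturation_mul_saturation_le S _ _ (Ideal.mul_mono hQt (le_saturation S L) hx)
  obtain ⟨s, hs, hstx⟩ := mem_saturation.1 htx
  obtain ⟨y, hy, hxy⟩ := Ideal.mem_span_singleton_mul.1 hstx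
  have ht0 : t ≠ 0 := fun h0 => ht (h0 ▸ Q.zero_mem)
  refine mem_saturation.2 ⟨s, hs, ?_⟩
  rwa [smul_eq_mul, ← mul_left_cancel₀ ht0 (hxy.trans (mul_left_comm s t x))]

theorem IsUniserialAt.isPrime_saturation [IsDomain R] (h : IsUniserialAt S R)
    (hI : I ≤ saturation S (I ^ 2)) (htop : saturation S I ≠ ⊤) :
    Ideal.IsPrime (saturation S I) := by
  refine ⟨htop, fun {a b} hab => ?_⟩
  by_contra! hcon
  obtain ⟨ha, hb⟩ := hcon
  have hI2 : I ^ 2 ≤ saturation S (Ideal.span {a * b}) := by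
    rw [pow_two, ← Ideal.span_singleton_mul_span_singleton]
    exact (Ideal.mul_mono (h.le_saturation_span_of_notMem ha)
      (h.le_saturation_span_of_notMem hb)).trans (saturation_mul_saturation_le S _ _)
  have hI_ab : I ≤ saturation S (Ideal.span {a * b}) := hI.trans (saturation_le_saturation hI2)
  have hab2 : a * b ∈ saturation S (Ideal.span {a * b} * Ideal.span {a * b}) := by
    refine saturation_le_saturation (hI.trans (saturation_le_saturation ?_)) hab
    rw [pow_two]
    exact (Ideal.mul_mono hI_ab hI_ab).trans (saturation_mul_saturation_le S _ _)
  obtain ⟨s, hs, hsab⟩ := mem_saturation.1 hab2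
  rw [Ideal.span_singleton_mul_span_singleton, Ideal.mem_span_singleton] at hsab
  obtain ⟨d, hd⟩ := hsab
  have hab0 : a * b ≠ 0 := fun h0 => by
    rcases mul_eq_zero.1 h0 with rfl | rfl
    exacts [ha (zero_mem _), hb (zero_mem _)]
  have hsd : s = a * b * d := mul_right_cancel₀ hab0 (by rw [← smul_eq_mul s, hd]; ring)
  refine htop ((Ideal.eq_top_iff_one _).2 ?_)
  refine saturation_le_saturation le_rfl (mem_saturation.2 ⟨s, hs, ?_⟩)
  rw [smul_eq_mul, mul_one, hsd]
  exact Ideal.mul_mem_right d _ hab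

end SaturationIdeal

section Closure

variable {D K : Type*} [CommRing D] [Field K] [Algebra D K] {E F : Submodule D K}

theorem one_div_anti (h : E ≤ F) : 1 / F ≤ 1 / E :=
  Submodule.le_div_iff_mul_le.2 <|
    (mul_le_mul_right h _).trans (mul_comm (1 / F) F ▸ Submodule.mul_one_div_le_one)

theorem mul_one_div_mul_le (E F : Submodule D K) : F * (1 / (E * F)) ≤ 1 / E := by
  rw [Submodule.le_div_iff_mul_le, mul_right_comm, mul_comm F E]
  exact Submodule.mul_one_div_le_one

theorem le_vClosure (E : Submodule D K) : E ≤ vClosure E :=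
  Submodule.le_div_iff_mul_le.2 Submodule.mul_one_div_le_one

theorem vClosure_vClosure (E : Submodule D K) : vClosure (vClosure E) = vClosure E :=
  (one_div_anti (le_vClosure (1 / E))).antisymm (le_vClosure _)

theorem mul_vClosure_le (E F : Submodule D K) : F * vClosure E ≤ vClosure (F * E) := by
  rw [vClosure, vClosure, Submodule.le_div_iff_mul_le, mul_right_comm, mul_comm F E]
  exact (mul_le_mul_left (mul_one_div_mul_le E F) _).trans Submodule.mul_one_div_le_one

theorem vClosure_span_singleton {a : K} (ha : a ≠ 0) : vClosure (D ∙ a) = D ∙ a := by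
  refine le_antisymm (fun x hx => ?_) (le_vClosure _)
  have hinv : a⁻¹ ∈ 1 / (D ∙ a) := by
    rw [Submodule.mem_div_iff_forall_mul_mem]
    rintro _ hy
    obtain ⟨d, rfl⟩ := Submodule.mem_span_singleton.1 hy
    rw [mul_smul_comm, inv_mul_cancel₀ ha]
    exact Submodule.smul_mem _ d (Submodule.one_le.1 le_rfl)
  obtain ⟨d, hd⟩ := Submodule.mem_one.1 (Submodule.mem_div_iff_forall_mul_mem.1 hx _ hinv)
  exact Submodule.mem_span_singleton.2 ⟨d, by rw [Algebra.smul_def, hd, inv_mul_cancel_right₀ ha]⟩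

theorem vClosure_one : vClosure (1 : Submodule D K) = 1 := by
  rw [Submodule.one_eq_span, vClosure_span_singleton one_ne_zero]

theorem le_tClosure (E : Submodule D K) : E ≤ tClosure E := fun x hx =>
  ⟨D ∙ x, Submodule.fg_span_singleton x, (Submodule.span_singleton_le_iff_mem x E).2 hx,
    le_vClosure _ (Submodule.mem_span_singleton_self x)⟩

theorem tClosure_le_vClosure (E : Submodule D K) : tClosure E ≤ vClosure E := by
  rintro x ⟨G, -, hGE, hx⟩
  exact vClosure_mono hGE hx

theorem exists_fg_le_vClosure_of_le_tClosure (hF : F.FG) (h : F ≤ tClosure E) :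
    ∃ G : Submodule D K, G.FG ∧ G ≤ E ∧ F ≤ vClosure G := by
  induction F, hF using Submodule.fg_induction with
  | singleton x =>
    obtain ⟨G, hG, hGE, hx⟩ := h (Submodule.mem_span_singleton_self x)
    exact ⟨G, hG, hGE, (Submodule.span_singleton_le_iff_mem x _).2 hx⟩
  | sup F₁ F₂ _ _ ih₁ ih₂ =>
    obtain ⟨G₁, hG₁, hE₁, h₁⟩ := ih₁ (le_sup_left.trans h)
    obtain ⟨G₂, hG₂, hE₂, h₂⟩ := ih₂ (le_sup_right.trans h)
    exact ⟨G₁ ⊔ G₂, hG₁.sup hG₂, sup_le hE₁ hE₂,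
      sup_le (h₁.trans (vClosure_mono le_sup_left)) (h₂.trans (vClosure_mono le_sup_right))⟩

theorem tClosure_le_tClosure (h : E ≤ tClosure F) : tClosure E ≤ tClosure F := by
  rintro x ⟨G, hG, hGE, hx⟩
  obtain ⟨H, hH, hHF, hGH⟩ := exists_fg_le_vClosure_of_le_tClosure hG (hGE.trans h)
  exact ⟨H, hH, hHF, vClosure_vClosure H ▸ vClosure_mono hGH hx⟩

theorem tClosure_mono (h : E ≤ F) : tClosure E ≤ tClosure F :=
  tClosure_le_tClosure (h.trans (le_tClosure F))

theorem tClosure_tClosure (E : Submodule D K) : tClosure (tClosure E) = tClosure E :=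
  (tClosure_le_tClosure le_rfl).antisymm (le_tClosure _)

theorem tClosure_one : tClosure (1 : Submodule D K) = 1 :=
  ((tClosure_le_vClosure _).trans vClosure_one.le).antisymm (le_tClosure _)

theorem mul_tClosure_le (E F : Submodule D K) : F * tClosure E ≤ tClosure (F * E) := by
  refine Submodule.mul_le.2 fun y hy x hx => ?_
  obtain ⟨G, hG, hGE, hx⟩ := hx
  have hyF : D ∙ y ≤ F := (Submodule.span_singleton_le_iff_mem y F).2 hy
  exact ⟨(D ∙ y) * G, (Submodule.fg_span_singleton y).mul hG, mul_le_mul' hyF hGE,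
    mul_vClosure_le _ _ (Submodule.mul_mem_mul (Submodule.mem_span_singleton_self y) hx)⟩

end Closure

section TIdeal

variable {D K : Type*} [CommRing D] [Field K] [Algebra D K] {I J : Ideal D}

theorem toK_le_one (I : Ideal D) : toK K I ≤ 1 :=
  (IsLocalization.coeSubmodule_mono K le_top).trans (IsLocalization.coeSubmodule_top K).le

theorem toK_mul (I J : Ideal D) : toK K (I * J) = toK K I * toK K J :=
  IsLocalization.coeSubmodule_mul K I J

theorem tClosure_toK_le_one (I : Ideal D) : tClosure (toK K I) ≤ 1 :=
  (tClosure_mono (toK_le_one I)).trans tClosure_one.le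

theorem IsTIdeal.tClosure_toK_le (hI : IsTIdeal K I) (h : J ≤ I) :
    tClosure (toK K J) ≤ toK K I :=
  (tClosure_mono (IsLocalization.coeSubmodule_mono K h)).trans hI.2.le

theorem IsDivisorial.vClosure_toK_le (hI : IsDivisorial K I) (h : J ≤ I) :
    vClosure (toK K J) ≤ toK K I :=
  (vClosure_mono (IsLocalization.coeSubmodule_mono K h)).trans hI.le

theorem toK_le_toK_iff [IsFractionRing D K] : toK K I ≤ toK K J ↔ I ≤ J :=
  IsFractionRing.coeSubmodule_le_coeSubmodule

variable [FaithfulSMul D K]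

theorem algebraMap_mem_toK {d : D} : algebraMap D K d ∈ toK K I ↔ d ∈ I :=
  (FaithfulSMul.algebraMap_injective D K).mem_set_image

theorem toK_ne_bot (h : I ≠ ⊥) : toK K I ≠ ⊥ := by
  rw [← IsLocalization.coeSubmodule_bot K]
  exact (Submodule.map_injective_of_injective (FaithfulSMul.algebraMap_injective D K)).ne h

theorem comap_saturation_toK (S : Submonoid D) (I : Ideal D) :
    (saturation S (toK K I)).comap (Algebra.linearMap D K) = saturation S I :=
  (comap_saturation _ S _).trans <| congrArg _ <|
    Submodule.comap_map_eq_of_injective (FaithfulSMul.algebraMap_injective D K) I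

theorem toK_le_saturation_iff {S : Submonoid D} :
    toK K J ≤ saturation S (toK K I) ↔ J ≤ saturation S I :=
  Submodule.map_le_iff_le_comap.trans (by rw [comap_saturation_toK])

theorem isTIdeal_iff :
    IsTIdeal K I ↔ I ≠ ⊥ ∧ ∀ d : D, algebraMap D K d ∈ tClosure (toK K I) → d ∈ I := by
  refine and_congr_right fun _ => ⟨fun h d hd => algebraMap_mem_toK.1 (h.le hd), fun h => ?_⟩
  refine le_antisymm (fun x hx => ?_) (le_tClosure _)
  obtain ⟨d, rfl⟩ := Submodule.mem_one.1 (tClosure_toK_le_one I hx)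
  exact algebraMap_mem_toK.2 (h d hx)

theorem isDivisorial_iff :
    IsDivisorial K I ↔ ∀ d : D, algebraMap D K d ∈ vClosure (toK K I) → d ∈ I := by
  refine ⟨fun h d hd => algebraMap_mem_toK.1 (h.le hd), fun h => ?_⟩
  refine le_antisymm (fun x hx => ?_) (le_vClosure _)
  obtain ⟨d, rfl⟩ := Submodule.mem_one.1 (vClosure_one.le (vClosure_mono (toK_le_one I) hx))
  exact algebraMap_mem_toK.2 (h d hx)

end TIdeal

section TMaximal

variable {D K : Type*} [CommRing D] [Field K] [Algebra D K] [IsFractionRing D K]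

theorem colon_singleton_ne_bot {E : Submodule D K} (hE : E ≠ ⊥) (x : K) : E.colon {x} ≠ ⊥ := by
  have : Nontrivial D := (algebraMap D K).domain_nontrivial
  obtain ⟨e, he, he0⟩ := Submodule.exists_mem_ne_zero_of_ne_bot hE
  obtain ⟨b, a, hab⟩ := IsLocalization.exists_integer_multiple (nonZeroDivisors D) (x / e)
  refine (Submodule.ne_bot_iff _).2 ⟨b, Submodule.mem_colon_singleton.2 ?_,
    nonZeroDivisors.coe_ne_zero b⟩
  have : (b : D) • x = a • e := by
    rw [Algebra.smul_def a, hab, smul_mul_assoc, div_mul_cancel₀ x he0]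
  exact this ▸ E.smul_mem a he

theorem isTIdeal_colon_singleton {E : Submodule D K} (hE0 : E ≠ ⊥)
    (hE : tClosure E ≤ E) (x : K) : IsTIdeal K (E.colon {x}) := by
  refine isTIdeal_iff.2 ⟨colon_singleton_ne_bot hE0 x, fun d hd => ?_⟩
  have hle : (D ∙ x) * toK K (E.colon {x}) ≤ E := by
    rintro y hy
    obtain ⟨z, hz, rfl⟩ := Submodule.mem_span_singleton_mul.1 hy
    obtain ⟨c, hc, rfl⟩ := (IsLocalization.mem_coeSubmodule K _).1 hz
    rw [mul_comm, ← Algebra.smul_def]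
    exact Submodule.mem_colon_singleton.1 hc
  rw [Submodule.mem_colon_singleton, Algebra.smul_def, mul_comm]
  exact hE (tClosure_mono hle (mul_tClosure_le _ _
    (Submodule.mul_mem_mul (Submodule.mem_span_singleton_self x) hd)))

theorem IsTIdeal.sSup_of_isChain {c : Set (Ideal D)} (hc : IsChain (· ≤ ·) c)
    (hne : c.Nonempty) (h : ∀ J ∈ c, IsTIdeal K J) : IsTIdeal K (sSup c) := by
  refine isTIdeal_iff.2 ⟨fun h0 => ?_, fun d ⟨F, hF, hFc, hd⟩ => ?_⟩
  · obtain ⟨J, hJ⟩ := hne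
    exact (h J hJ).1 (eq_bot_mono (le_sSup hJ) h0)
  · have hsSup : toK K (sSup c) = sSup (toK K '' c) :=
      (Submodule.gc_map_comap (Algebra.linearMap D K)).l_sSup.trans sSup_image.symm
    have hdir : DirectedOn (· ≤ ·) (toK K '' c) :=
      (hc.image_of_map_rel _ (· ≤ ·) _ fun _ _ => IsLocalization.coeSubmodule_mono K).directedOn
    obtain ⟨_, ⟨J, hJ, rfl⟩, hFJ⟩ :=
      (CompleteLattice.isCompactElement_iff_le_of_directed_sSup_le _ F).1
        ((Submodule.fg_iff_compact F).1 hF) _ (hne.image _) hdir (hsSup ▸ hFc)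
    exact le_sSup hJ ((isTIdeal_iff.1 (h J hJ)).2 d ⟨F, hF, hFJ, hd⟩)

theorem IsTIdeal.exists_le_isTMaximal {I : Ideal D} (hI : IsTIdeal K I) (h : I ≠ ⊤) :
    ∃ M, IsTMaximal K M ∧ I ≤ M := by
  suffices hchain : ∀ c ⊆ {J : Ideal D | J ≠ ⊤ ∧ IsTIdeal K J}, IsChain (· ≤ ·) c →
      ∀ J ∈ c, ∃ U ∈ {J : Ideal D | J ≠ ⊤ ∧ IsTIdeal K J}, ∀ J ∈ c, J ≤ U by
    obtain ⟨M, hIM, hM⟩ := zorn_le_nonempty₀ _ hchain I ⟨h, hI⟩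
    exact ⟨M, hM, hIM⟩
  intro c hcs hc J hJ
  refine ⟨sSup c, ⟨fun htop => ?_, .sSup_of_isChain hc ⟨J, hJ⟩ fun J hJ => (hcs hJ).2⟩,
    fun _ => le_sSup⟩
  obtain ⟨J, hJ, h1⟩ := (Submodule.mem_sSup_of_directed ⟨J, hJ⟩ hc.directedOn).1
    ((Ideal.eq_top_iff_one _).1 htop)
  exact (hcs hJ).1 ((Ideal.eq_top_iff_one _).2 h1)

theorem IsTMaximal.isPrime {M : Ideal D} (hM : IsTMaximal K M) : M.IsPrime := by
  refine ⟨hM.prop.1, fun {a b} hab => or_iff_not_imp_left.2 fun ha => ?_⟩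
  set C := (toK K M).colon {algebraMap D K a}
  have mem_C {d : D} : d ∈ C ↔ d * a ∈ M := by
    rw [Submodule.mem_colon_singleton, Algebra.smul_def, ← map_mul, algebraMap_mem_toK]
  have hC : IsTIdeal K C := isTIdeal_colon_singleton (toK_ne_bot hM.prop.2.1) hM.prop.2.2.le _
  have hCtop : C ≠ ⊤ := fun h => ha (one_mul a ▸ mem_C.1 ((Ideal.eq_top_iff_one _).1 h))
  exact hM.le_of_ge ⟨hCtop, hC⟩ (fun m hm => mem_C.2 (M.mul_mem_right a hm))
    (mem_C.2 (mul_comm a b ▸ hab))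

theorem le_tClosure_of_forall_le_saturation {E F : Submodule D K} (hF : F ≠ ⊥)
    (h : ∀ (M : Ideal D) [M.IsPrime], IsTMaximal K M → E ≤ saturation M.primeCompl F) :
    E ≤ tClosure F := by
  intro x hx
  have hC : IsTIdeal K ((tClosure F).colon {x}) :=
    isTIdeal_colon_singleton (ne_bot_of_le_ne_bot hF (le_tClosure F)) (tClosure_tClosure F).le x
  suffices hC1 : (1 : D) ∈ (tClosure F).colon {x} by
    rwa [Submodule.mem_colon_singleton, one_smul] at hC1
  by_contra hC1
  obtain ⟨M, hM, hCM⟩ := hC.exists_le_isTMaximal ((Ideal.ne_top_iff_one _).2 hC1)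
  have := hM.isPrime
  obtain ⟨s, hsM, hsx⟩ := mem_saturation.1 (h M hM hx)
  exact hsM (hCM (Submodule.mem_colon_singleton.2 (le_tClosure F hsx)))

theorem toK_le_tClosure_of_forall_le_saturation {I J : Ideal D} (hI : I ≠ ⊥)
    (h : ∀ (M : Ideal D) [M.IsPrime], IsTMaximal K M → J ≤ saturation M.primeCompl I) :
    toK K J ≤ tClosure (toK K I) :=
  le_tClosure_of_forall_le_saturation (toK_ne_bot hI) fun M _ hM =>
    toK_le_saturation_iff.2 (h M hM)

end TMaximal

section PvMD

variable {D K : Type*} [CommRing D] [Field K] [Algebra D K] [IsFractionRing D K]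
  {S : Submonoid D} {M I J : Ideal D}

theorem mem_saturation_span_of_mul_notMem [M.IsPrime] {F : Submodule D K} {x y g : K} (hx : x ∈ F)
    (hy : y ∈ F) (hg : g ∈ 1 / F) (h : x * g ∉ toK K M) :
    y ∈ saturation M.primeCompl (D ∙ x) := by
  rw [Submodule.mem_div_iff_forall_mul_mem] at hg
  obtain ⟨s, hs⟩ := Submodule.mem_one.1 (hg x hx)
  obtain ⟨t, ht⟩ := Submodule.mem_one.1 (hg y hy)
  have hsM : s ∉ M := by rwa [mul_comm, ← hs, algebraMap_mem_toK] at h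
  refine mem_saturation.2 ⟨s, hsM, Submodule.mem_span_singleton.2 ⟨t, ?_⟩⟩
  rw [Algebra.smul_def, Algebra.smul_def, hs, ht, mul_right_comm]

theorem IsPvMD.isUniserialAt (hD : IsPvMD D K) [hMp : M.IsPrime] (hM : IsTIdeal K M) :
    IsUniserialAt M.primeCompl K := by
  intro x y
  rcases eq_or_ne x 0 with rfl | hx0
  · exact .inl (zero_mem _)
  set F : Submodule D K := (D ∙ x) ⊔ (D ∙ y)
  have hxF : x ∈ F := Submodule.mem_sup_left (Submodule.mem_span_singleton_self x)
  have hyF : y ∈ F := Submodule.mem_sup_right (Submodule.mem_span_singleton_self y)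
  have hinv : tClosure (F * (1 / F)) = 1 := hD F ((Submodule.ne_bot_iff F).2 ⟨x, hxF, hx0⟩)
    ((Submodule.fg_span_singleton x).sup (Submodule.fg_span_singleton y))
  by_contra! h
  have hgM {a g : K} (ha : a = x ∨ a = y) (hg : g ∈ 1 / F) : a * g ∈ toK K M := by
    by_contra hag
    rcases ha with rfl | rfl
    exacts [h.2 (mem_saturation_span_of_mul_notMem hxF hyF hg hag),
      h.1 (mem_saturation_span_of_mul_notMem hyF hxF hg hag)]
  have hle : F * (1 / F) ≤ toK K M := by
    rw [Submodule.sup_mul]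
    refine sup_le (fun z hz => ?_) fun z hz => ?_ <;>
      obtain ⟨g, hg, rfl⟩ := Submodule.mem_span_singleton_mul.1 hz
    exacts [hgM (.inl rfl) hg, hgM (.inr rfl) hg]
  have htop : toK K ⊤ ≤ toK K M := by
    rw [toK, IsLocalization.coeSubmodule_top, ← hinv, ← hM.2]
    exact tClosure_mono hle
  exact hMp.ne_top (top_le_iff.1 (toK_le_toK_iff.1 htop))

theorem IsUniserialAt.of_isFractionRing (h : IsUniserialAt S K) : IsUniserialAt S D :=
  h.of_injective (f := Algebra.linearMap D K) (IsFractionRing.injective D K)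

theorem IsUniserialAt.vClosure_le_saturation (h : IsUniserialAt S K)
    (hS : S ≤ nonZeroDivisors D) {F : Submodule D K} (hF : F.FG) (hF0 : F ≠ ⊥) :
    vClosure F ≤ saturation S F := by
  obtain ⟨a, haF, ha⟩ := h.exists_mem_le_saturation_span hF
  obtain ⟨s, hs, hsF⟩ := exists_smul_mem_of_fg hF ha
  have : Nontrivial D := (algebraMap D K).domain_nontrivial
  have hs0 : algebraMap D K s ≠ 0 := IsFractionRing.to_map_ne_zero_of_mem_nonZeroDivisors (hS hs)
  set c := a / algebraMap D K s with hc
  have hsc : s • c = a := by rw [Algebra.smul_def, hc, mul_div_cancel₀ a hs0]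
  have hFc : F ≤ D ∙ c := by
    intro x hx
    obtain ⟨d, hd⟩ := Submodule.mem_span_singleton.1 (hsF x hx)
    refine Submodule.mem_span_singleton.2 ⟨d, mul_left_cancel₀ hs0 ?_⟩
    rw [← Algebra.smul_def, ← Algebra.smul_def, smul_comm, hsc, hd]
  have hc0 : c ≠ 0 := fun h0 => hF0 (by simpa [h0] using hFc)
  intro x hx
  have hxc : x ∈ D ∙ c := vClosure_span_singleton (D := D) hc0 ▸ vClosure_mono hFc hx
  obtain ⟨d, rfl⟩ := Submodule.mem_span_singleton.1 hxc
  exact mem_saturation.2 ⟨s, hs, by rw [smul_comm, hsc]; exact F.smul_mem d haF⟩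

theorem IsUniserialAt.tClosure_le_saturation (h : IsUniserialAt S K)
    (hS : S ≤ nonZeroDivisors D) {E : Submodule D K} (hE : E ≠ ⊥) :
    tClosure E ≤ saturation S E := by
  rintro x ⟨F, hF, hFE, hx⟩
  obtain ⟨e, he, he0⟩ := Submodule.exists_mem_ne_zero_of_ne_bot hE
  have heE : D ∙ e ≤ E := (Submodule.span_singleton_le_iff_mem e E).2 he
  have hne : F ⊔ D ∙ e ≠ ⊥ := fun h0 =>
    he0 (Submodule.span_singleton_eq_bot.1 (sup_eq_bot_iff.1 h0).2)
  exact saturation_mono (sup_le hFE heE) <| h.vClosure_le_saturation hS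
    (hF.sup (Submodule.fg_span_singleton e)) hne (vClosure_mono le_sup_left hx)

theorem IsUniserialAt.isTIdeal_saturation (h : IsUniserialAt S K) (hS : S ≤ nonZeroDivisors D)
    (hI : I ≠ ⊥) : IsTIdeal K (saturation S I) := by
  have hne : saturation S I ≠ ⊥ := ne_bot_of_le_ne_bot hI (le_saturation S I)
  refine isTIdeal_iff.2 ⟨hne, fun d hd => ?_⟩
  replace hd := saturation_le_saturation (toK_le_saturation_iff.2 le_rfl)
    (h.tClosure_le_saturation hS (toK_ne_bot hne) hd)
  exact (comap_saturation_toK S I).le hd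

variable [IsDomain D]

theorem IsTIdempotent.le_saturation (hD : IsPvMD D K) (hI0 : I ≠ ⊥) (hI : IsTIdempotent K I)
    [M.IsPrime] (hM : IsTIdeal K M) : I ≤ saturation M.primeCompl (I ^ 2) := by
  rw [← toK_le_saturation_iff (K := K)]
  exact (le_tClosure _).trans <| hI.le.trans <| (hD.isUniserialAt hM).tClosure_le_saturation
    M.primeCompl_le_nonZeroDivisors (toK_ne_bot (pow_ne_zero 2 hI0))

theorem isTIdempotent_of_forall_le_saturation (hI0 : I ≠ ⊥)
    (h : ∀ (M : Ideal D) [M.IsPrime], IsTMaximal K M → I ≤ saturation M.primeCompl (I ^ 2)) :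
    IsTIdempotent K I :=
  (tClosure_le_tClosure (toK_le_tClosure_of_forall_le_saturation (pow_ne_zero 2 hI0) h)).antisymm
    (tClosure_mono (IsLocalization.coeSubmodule_mono K (Ideal.pow_le_self two_ne_zero)))

theorem IsTIdempotent.isTPrime_saturation (hD : IsPvMD D K) (hI0 : I ≠ ⊥)
    (hI : IsTIdempotent K I) [hMp : M.IsPrime] (hM : IsTIdeal K M) (hIM : I ≤ M) :
    IsTPrime K (saturation M.primeCompl I) :=
  have hU := hD.isUniserialAt hM
  ⟨hU.of_isFractionRing.isPrime_saturation (hI.le_saturation hD hI0 hM)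
    (ne_top_of_le_ne_top hMp.ne_top (saturation_le_of_isPrime le_rfl hIM)),
    hU.isTIdeal_saturation M.primeCompl_le_nonZeroDivisors hI0⟩

theorem IsTIdempotent.saturation (hD : IsPvMD D K) (hI0 : I ≠ ⊥) (hI : IsTIdempotent K I)
    [M.IsPrime] (hM : IsTIdeal K M) (hIM : I ≤ M) :
    IsTIdempotent K (saturation M.primeCompl I) := by
  obtain ⟨hQ, hQt⟩ := hI.isTPrime_saturation hD hI0 hM hIM
  set Q : Ideal D := StarOp.saturation M.primeCompl I
  have hQM : Q ≤ M := saturation_le_of_isPrime le_rfl hIM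
  have hQ_M : Q ≤ StarOp.saturation M.primeCompl (Q * Q) :=
    (saturation_le_saturation (hI.le_saturation hD hI0 hM)).trans
      (saturation_mono (pow_two Q ▸ Ideal.pow_right_mono (StarOp.le_saturation _ I) 2))
  refine isTIdempotent_of_forall_le_saturation hQt.1 fun N _ hN => ?_
  rw [pow_two]
  by_cases hQN : Q ≤ N
  · exact (hQ_M.trans (saturation_mono_left (primeCompl_le_primeCompl hQM) _)).trans
      ((hD.isUniserialAt hN.prop.2).of_isFractionRing.saturation_primeCompl_mul_le
        (primeCompl_le_primeCompl hQN) Q)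
  · have hQQ : ¬ Q * Q ≤ N := fun h => hQN (Ideal.IsPrime.le_of_pow_le (n := 2) (pow_two Q ▸ h))
    exact (saturation_primeCompl_eq_top hQQ).ge.trans' le_top

theorem IsTIdempotent.mul (hD : IsPvMD D K) (hI0 : I ≠ ⊥) (hJ0 : J ≠ ⊥)
    (hI : IsTIdempotent K I) (hJ : IsTIdempotent K J) : IsTIdempotent K (I * J) := by
  refine isTIdempotent_of_forall_le_saturation (mul_ne_zero hI0 hJ0) fun M _ hM => ?_
  rw [mul_pow]
  exact (Ideal.mul_mono (hI.le_saturation hD hI0 hM.prop.2)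
    (hJ.le_saturation hD hJ0 hM.prop.2)).trans (saturation_mul_saturation_le _ _ _)

end PvMD

section Incomparable

variable {R : Type*} [CommRing R] {s : Multiset (Ideal R)} {M P Q : Ideal R}

theorem mem_multiset_inf {d : R} : d ∈ s.inf ↔ ∀ P ∈ s, d ∈ P := by
  simp only [← Ideal.span_singleton_le_iff_mem, Multiset.le_inf]

theorem Incomparable.eq_of_le (hs : Incomparable s) (hP : P ∈ s) (hQ : Q ∈ s) (h : P ≤ Q) :
    P = Q := by
  by_contra hne
  exact hs.2 P hP Q hQ hne h

theorem Incomparable.not_prod_erase_le [DecidableEq (Ideal R)] (hs : Incomparable s)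
    (hprime : ∀ Q ∈ s, Q.IsPrime) [hM : M.IsPrime] (h : IsUniserialAt M.primeCompl R)
    (hP : P ∈ s) (hPM : P ≤ M) : ¬ (s.erase P).prod ≤ M := by
  intro hle
  obtain ⟨Q, hQ, hQM⟩ := hM.multiset_prod_le.1 hle
  have hQs : Q ∈ s := Multiset.mem_of_mem_erase hQ
  have := hprime P hP
  have := hprime Q hQs
  have hPQ : P = Q := by
    rcases h.le_or_le_of_isPrime (primeCompl_le_primeCompl hPM) (primeCompl_le_primeCompl hQM)
      with hle | hle
    exacts [hs.eq_of_le hP hQs hle, (hs.eq_of_le hQs hP hle).symm]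
  exact hs.1.notMem_erase (hPQ ▸ hQ)

theorem Incomparable.inf_le_saturation_prod (hs : Incomparable s)
    (hprime : ∀ Q ∈ s, Q.IsPrime) [hM : M.IsPrime] (h : IsUniserialAt M.primeCompl R) :
    s.inf ≤ saturation M.primeCompl s.prod := by
  classical
  by_cases hsM : s.prod ≤ M
  · obtain ⟨P, hP, hPM⟩ := hM.multiset_prod_le.1 hsM
    obtain ⟨u, hu, huM⟩ := SetLike.not_le_iff_exists.1 (hs.not_prod_erase_le hprime h hP hPM)
    refine fun d hd => mem_saturation.2 ⟨u, huM, ?_⟩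
    rw [smul_eq_mul, mul_comm u, ← Multiset.cons_erase hP, Multiset.prod_cons]
    exact Ideal.mul_mem_mul (mem_multiset_inf.1 hd P hP) hu
  · exact le_top.trans (saturation_primeCompl_eq_top hsM).ge

theorem exists_incomparable_inf_eq_sInf {A : Set (Ideal R)} (hA : A.Finite) :
    ∃ s : Multiset (Ideal R), (∀ P ∈ s, P ∈ A) ∧ Incomparable s ∧ s.inf = sInf A := by
  have hfin : {P | Minimal (· ∈ A) P}.Finite := hA.subset fun P hP => hP.prop
  have mem_iff {P : Ideal R} : P ∈ hfin.toFinset.val ↔ Minimal (· ∈ A) P :=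
    hfin.mem_toFinset
  refine ⟨hfin.toFinset.val, fun P hP => (mem_iff.1 hP).prop, ⟨Finset.nodup _, ?_⟩, ?_⟩
  · exact fun P hP Q hQ hne hle => hne ((mem_iff.1 hQ).eq_of_le (mem_iff.1 hP).prop hle)
  · refine le_antisymm (le_sInf fun P hP => ?_)
      (Multiset.le_inf.2 fun P hP => sInf_le (mem_iff.1 hP).prop)
    obtain ⟨Q, hQP, hQ⟩ := hA.exists_le_minimal hP
    exact (Multiset.inf_le (mem_iff.2 hQ)).trans hQP

end Incomparable

section TProduct

variable {D K : Type*} [CommRing D] [Field K] [Algebra D K] {I P : Ideal D}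
  {s u : Multiset (Ideal D)}

theorem HasFiniteTCharacter.finite_isTMaximal_ge (hfc : HasFiniteTCharacter D K) (hI : I ≠ ⊥) :
    {M : Ideal D | IsTMaximal K M ∧ I ≤ M}.Finite := by
  obtain ⟨x, hx, hx0⟩ := Submodule.exists_mem_ne_zero_of_ne_bot hI
  exact (hfc x hx0).subset fun M hM => ⟨hM.1, hM.2 hx⟩

variable [IsFractionRing D K]

theorem IsTProduct.prod_le (h : IsTProduct K I s) : s.prod ≤ I :=
  (toK_le_toK_iff (K := K)).1 ((le_tClosure _).trans h.ge)

theorem IsTProduct.le_of_mem (h : IsTProduct K I s) (hPs : P ∈ s) (hP : IsTIdeal K P) : I ≤ P :=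
  (toK_le_toK_iff (K := K)).1 <|
    h.le.trans (hP.tClosure_toK_le (Ideal.multiset_prod_le_inf.trans (Multiset.inf_le hPs)))

theorem IsTProduct.mem_of_mem_incomparable (hs : ∀ P ∈ s, IsTPrime K P)
    (hu : ∀ P ∈ u, IsTPrime K P) (hinc : Incomparable s) (hIs : IsTProduct K I s)
    (hIu : IsTProduct K I u) (hP : P ∈ s) : P ∈ u := by
  obtain ⟨Q, hQ, hQP⟩ := (hs P hP).1.multiset_prod_le.1
    (hIu.prod_le.trans (hIs.le_of_mem hP (hs P hP).2))
  obtain ⟨P', hP', hP'Q⟩ := (hu Q hQ).1.multiset_prod_le.1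
    (hIs.prod_le.trans (hIu.le_of_mem hQ (hu Q hQ).2))
  obtain rfl : P' = P := hinc.eq_of_le hP' hP (hP'Q.trans hQP)
  exact hP'Q.antisymm hQP ▸ hQ

theorem IsTProduct.eq_of_incomparable (hs : ∀ P ∈ s, IsTPrime K P) (hu : ∀ P ∈ u, IsTPrime K P)
    (hs_inc : Incomparable s) (hu_inc : Incomparable u) (hIs : IsTProduct K I s)
    (hIu : IsTProduct K I u) : s = u :=
  (hs_inc.1.ext hu_inc.1).2 fun _ =>
    ⟨hIs.mem_of_mem_incomparable hs hu hs_inc hIu, hIu.mem_of_mem_incomparable hu hs hu_inc hIs⟩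

variable (K) in
/-- The contractions `I D_M ∩ D` of `I` at the `t`-maximal ideals `M` containing `I`. -/
def tMaximalContractions (I : Ideal D) : Set (Ideal D) :=
  {Q | ∃ (M : Ideal D) (_ : M.IsPrime), IsTMaximal K M ∧ I ≤ M ∧ Q = saturation M.primeCompl I}

theorem IsTIdeal.sInf_tMaximalContractions (hI : IsTIdeal K I) :
    sInf (tMaximalContractions K I) = I := by
  refine le_antisymm ((toK_le_toK_iff (K := K)).1 ?_) (le_sInf ?_)
  · refine (toK_le_tClosure_of_forall_le_saturation hI.1 fun M hM hMt => ?_).trans hI.2.le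
    by_cases hIM : I ≤ M
    · exact sInf_le ⟨M, hM, hMt, hIM, rfl⟩
    · exact le_top.trans (saturation_primeCompl_eq_top hIM).ge
  · rintro _ ⟨M, _, -, -, rfl⟩
    exact le_saturation M.primeCompl I

theorem HasFiniteTCharacter.finite_tMaximalContractions (hfc : HasFiniteTCharacter D K)
    (hI : I ≠ ⊥) : (tMaximalContractions K I).Finite := by
  refine ((hfc.finite_isTMaximal_ge hI).dependent_image fun M hM =>
    have := hM.1.isPrime
    saturation M.primeCompl I).subset ?_
  rintro _ ⟨M, _, hM, hIM, rfl⟩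
  exact ⟨M, ⟨hM, hIM⟩, rfl⟩

variable [IsDomain D]

theorem IsPvMD.tClosure_toK_prod (hD : IsPvMD D K) (hs : Incomparable s)
    (h : ∀ P ∈ s, IsTPrime K P) : tClosure (toK K s.prod) = toK K s.inf := by
  have hprod : s.prod ≠ ⊥ := Multiset.prod_ne_zero fun h0 => (h _ h0).2.1 rfl
  refine le_antisymm (fun x hx => ?_)
    (toK_le_tClosure_of_forall_le_saturation hprod fun M _ hM =>
      hs.inf_le_saturation_prod (fun P hP => (h P hP).1)
        (hD.isUniserialAt hM.prop.2).of_isFractionRing)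
  obtain ⟨d, rfl⟩ := Submodule.mem_one.1 (tClosure_toK_le_one _ hx)
  refine algebraMap_mem_toK.2 (mem_multiset_inf.2 fun P hP =>
    (algebraMap_mem_toK (K := K)).1 ?_)
  exact (h P hP).2.tClosure_toK_le (Ideal.multiset_prod_le_inf.trans (Multiset.inf_le hP)) hx

theorem IsPvMD.isTProduct_iff_eq_inf (hD : IsPvMD D K) (hs : Incomparable s)
    (h : ∀ P ∈ s, IsTPrime K P) : IsTProduct K I s ↔ I = s.inf := by
  rw [IsTProduct, hD.tClosure_toK_prod hs h]
  exact (IsFractionRing.coeSubmodule_injective D K).eq_iff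

theorem isTIdempotent_multiset_prod (hD : IsPvMD D K)
    (h : ∀ P ∈ s, IsTPrime K P ∧ IsTIdempotent K P) : IsTIdempotent K s.prod := by
  induction s using Multiset.induction with
  | empty => rw [Multiset.prod_zero, IsTIdempotent, one_pow]
  | cons P s ih =>
    obtain ⟨hP, hs⟩ := Multiset.forall_mem_cons.1 h
    have hprod : s.prod ≠ ⊥ := Multiset.prod_ne_zero fun h0 => (hs _ h0).1.2.1 rfl
    rw [Multiset.prod_cons]
    exact hP.2.mul hD hP.1.2.1 hprod (ih hs)

theorem IsTProduct.isTIdempotent (hD : IsPvMD D K)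
    (h : ∀ P ∈ s, IsTPrime K P ∧ IsTIdempotent K P) (hI : IsTProduct K I s) :
    IsTIdempotent K I := by
  refine le_antisymm ?_
    (tClosure_mono (IsLocalization.coeSubmodule_mono K (Ideal.pow_le_self two_ne_zero)))
  rw [hI, tClosure_tClosure, isTIdempotent_multiset_prod hD h]
  exact tClosure_mono (IsLocalization.coeSubmodule_mono K (Ideal.pow_right_mono hI.prod_le 2))

theorem IsTIdempotent.exists_incomparable_isTProduct (hD : IsPvMD D K)
    (hfc : HasFiniteTCharacter D K) (hI : IsTIdeal K I) (hidem : IsTIdempotent K I) :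
    ∃ s : Multiset (Ideal D), (∀ P ∈ s, IsTPrime K P ∧ IsTIdempotent K P) ∧
      Incomparable s ∧ IsTProduct K I s := by
  obtain ⟨s, hsA, hs, hinf⟩ :=
    exists_incomparable_inf_eq_sInf (hfc.finite_tMaximalContractions hI.1)
  have hprime : ∀ P ∈ s, IsTPrime K P ∧ IsTIdempotent K P := by
    intro P hP
    obtain ⟨M, _, hM, hIM, rfl⟩ := hsA P hP
    exact ⟨hidem.isTPrime_saturation hD hI.1 hM.prop.2 hIM,
      hidem.saturation hD hI.1 hM.prop.2 hIM⟩
  refine ⟨s, hprime, hs, (hD.isTProduct_iff_eq_inf hs fun P hP => (hprime P hP).1).2 ?_⟩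
  rw [hinf, hI.sInf_tMaximalContractions]

end TProduct

section Divisorial

variable {D K : Type*} [CommRing D] [Field K] [Algebra D K] {I J M P : Ideal D}

theorem IsTIdempotent.one_div_mul_le (hI : IsTIdeal K I) (hidem : IsTIdempotent K I) :
    1 / toK K I * toK K I ≤ toK K I := by
  have hsq : 1 / toK K I * toK K (I ^ 2) ≤ toK K I := by
    rw [pow_two, toK_mul, ← mul_assoc, mul_comm (1 / _)]
    exact (mul_le_mul_left Submodule.mul_one_div_le_one _).trans (one_mul _).le
  calc 1 / toK K I * toK K I
      ≤ 1 / toK K I * tClosure (toK K (I ^ 2)) :=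
        mul_le_mul_right ((le_tClosure _).trans hidem.le) _
    _ ≤ tClosure (1 / toK K I * toK K (I ^ 2)) := mul_tClosure_le _ _
    _ ≤ tClosure (toK K I) := tClosure_mono hsq
    _ = toK K I := hI.2

theorem IsTPrime.exists_notMem_forall_isTMaximal (hfc : HasFiniteTCharacter D K)
    (hP : IsTPrime K P) (hmax : ¬ IsTMaximal K P) :
    ∃ a ∉ P, ∀ M, IsTMaximal K M → P ≤ M → a ∈ M := by
  have hex : ∀ M, IsTMaximal K M → ∃ c ∈ M, c ∉ P := by
    refine fun M hM => SetLike.not_le_iff_exists.1 fun hle => hmax ?_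
    rwa [← hM.eq_of_le ⟨hP.1.ne_top, hP.2⟩ hle]
  choose! c hcM hcP using hex
  have hfin := hfc.finite_isTMaximal_ge hP.2.1
  refine ⟨∏ M ∈ hfin.toFinset, c M, fun hmem => ?_, fun M hM hPM => ?_⟩
  · obtain ⟨M, hM, hc⟩ := hP.1.prod_mem_iff.1 hmem
    exact hcP M (hfin.mem_toFinset.1 hM).1 hc
  · exact Ideal.mem_of_dvd M (Finset.dvd_prod_of_mem c (hfin.mem_toFinset.2 ⟨hM, hPM⟩))
      (hcM M hM)

theorem HasFiniteTCharacter.exists_fg_le_forall_isTMaximal (hfc : HasFiniteTCharacter D K)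
    (hI : I ≠ ⊥) :
    ∃ F : Ideal D, F.FG ∧ F ≤ I ∧ ∀ M, IsTMaximal K M → F ≤ M → I ≤ M := by
  obtain ⟨p, hp, hp0⟩ := Submodule.exists_mem_ne_zero_of_ne_bot hI
  have hex : ∀ M : Ideal D, ∃ e ∈ I, ¬ I ≤ M → e ∉ M := fun M => by
    by_cases hIM : I ≤ M
    · exact ⟨p, hp, fun h => absurd hIM h⟩
    · obtain ⟨e, he, heM⟩ := SetLike.not_le_iff_exists.1 hIM
      exact ⟨e, he, fun _ => heM⟩
  choose e heI heM using hex
  refine ⟨_, Submodule.fg_span (((hfc p hp0).image e).insert p), Ideal.span_le.2 ?_,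
    fun M hM hle => ?_⟩
  · rintro x (rfl | ⟨M, -, rfl⟩)
    exacts [hp, heI M]
  · by_contra hIM
    have hpM : p ∈ M := hle (Ideal.subset_span (Set.mem_insert _ _))
    exact heM M hIM (hle (Ideal.subset_span (.inr ⟨M, ⟨hM, hpM⟩, rfl⟩)))

theorem IsDivisorial.multiset_inf [FaithfulSMul D K] {s : Multiset (Ideal D)}
    (h : ∀ P ∈ s, IsDivisorial K P) : IsDivisorial K s.inf :=
  isDivisorial_iff.2 fun _ hd => mem_multiset_inf.2 fun P hP =>
    algebraMap_mem_toK.1 ((h P hP).vClosure_toK_le (Multiset.inf_le hP) hd)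

variable [IsFractionRing D K]

theorem IsTMaximal.one_div_le_one (hD : IsPvMD D K) (hM : IsTMaximal K M)
    (hidem : IsTIdempotent K M) : 1 / toK K M ≤ 1 := by
  refine (le_tClosure_of_forall_le_saturation one_ne_zero fun N _ hN y hy => ?_).trans
    tClosure_one.le
  have hyM {m : D} (hm : m ∈ M) : m • y ∈ toK K M := by
    rw [Algebra.smul_def, mul_comm]
    exact hidem.one_div_mul_le hM.prop.2 (Submodule.mul_mem_mul hy (algebraMap_mem_toK.2 hm))
  by_cases hMN : M ≤ N
  · obtain rfl : M = N := hM.eq_of_le hN.prop hMN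
    rcases hD.isUniserialAt hN.prop.2 y 1 with hy1 | h1y
    · rwa [Submodule.one_eq_span]
    · obtain ⟨s, hs, hsy⟩ := mem_saturation.1 h1y
      obtain ⟨d, hd⟩ := Submodule.mem_span_singleton.1 hsy
      have hs1 : s • (1 : K) = algebraMap D K s := (Algebra.algebraMap_eq_smul_one s).symm
      have hdM : d ∉ M := fun hdM => hs (algebraMap_mem_toK.1 (hs1 ▸ hd ▸ hyM hdM))
      exact mem_saturation.2 ⟨d, hdM, Submodule.mem_one.2 ⟨s, by rw [hd, hs1]⟩⟩
  · obtain ⟨u, hu, huN⟩ := SetLike.not_le_iff_exists.1 hMN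
    exact mem_saturation.2 ⟨u, huN, toK_le_one M (hyM hu)⟩

theorem IsDivisorial.le_of_mul_le (hI : IsDivisorial K I) (hM : 1 / toK K M ≤ 1)
    (h : M * J ≤ I) : J ≤ I := by
  have hinv : 1 / toK K (M * J) ≤ 1 / toK K J := by
    rw [Submodule.le_div_iff_mul_le, mul_comm, toK_mul]
    exact (mul_one_div_mul_le _ _).trans hM
  refine (toK_le_toK_iff (K := K)).1 ?_
  calc toK K J ≤ vClosure (toK K J) := le_vClosure _
    _ ≤ vClosure (toK K (M * J)) := one_div_anti hinv
    _ ≤ toK K I := hI.vClosure_toK_le h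

theorem IsDivisorial.not_isTMaximal_of_mem (hD : IsPvMD D K) (hdiv : IsDivisorial K I)
    {s : Multiset (Ideal D)} (h : ∀ P ∈ s, IsTPrime K P ∧ IsTIdempotent K P)
    (hs : Incomparable s) (hI : IsTProduct K I s) (hMs : M ∈ s) : ¬ IsTMaximal K M := by
  classical
  intro hM
  have := hM.isPrime
  refine hs.not_prod_erase_le (fun P hP => (h P hP).1.1)
    (hD.isUniserialAt hM.prop.2).of_isFractionRing hMs le_rfl ?_
  refine (hdiv.le_of_mul_le (hM.one_div_le_one hD (h M hMs).2) ?_).trans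
    (hI.le_of_mem hMs hM.prop.2)
  rw [← Multiset.prod_cons, Multiset.cons_erase hMs]
  exact hI.prod_le

theorem IsTPrime.toK_le_tClosure_sup_span (hD : IsPvMD D K) (hP : IsTPrime K P) {F : Ideal D}
    (hF : ∀ M, IsTMaximal K M → F ≤ M → P ≤ M) {b : D} (hb : b ∉ P) :
    toK K P ≤ tClosure (toK K (F ⊔ Ideal.span {b})) := by
  have := hP.1
  have hne : F ⊔ Ideal.span {b} ≠ ⊥ := fun h0 =>
    hb (Ideal.span_singleton_eq_bot.1 (sup_eq_bot_iff.1 h0).2 ▸ P.zero_mem)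
  refine toK_le_tClosure_of_forall_le_saturation hne fun M _ hM => ?_
  by_cases hPM : P ≤ M
  · exact ((hD.isUniserialAt hM.prop.2).of_isFractionRing.le_saturation_span_of_isPrime
      (primeCompl_le_primeCompl hPM) hb).trans (saturation_mono le_sup_right)
  · have hM' : ¬ F ⊔ Ideal.span {b} ≤ M := fun h => hPM (hF M hM (le_sup_left.trans h))
    exact le_top.trans (saturation_primeCompl_eq_top hM').ge

variable [IsDomain D]

theorem IsTPrime.vClosure_toK_le_saturation_span (hD : IsPvMD D K)
    (hfc : HasFiniteTCharacter D K) (hP : IsTPrime K P) [M.IsPrime] (hM : IsTIdeal K M)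
    (hPM : P ≤ M) {b : D} (hb : b ∉ P) :
    vClosure (toK K P) ≤ saturation M.primeCompl (toK K (Ideal.span {b})) := by
  have := hP.1
  have hU := hD.isUniserialAt hM
  obtain ⟨F, hF, hFP, hFM⟩ := hfc.exists_fg_le_forall_isTMaximal hP.2.1
  set J := F ⊔ Ideal.span {b}
  have hPJ : toK K P ≤ vClosure (toK K J) :=
    (hP.toK_le_tClosure_sup_span hD hFM hb).trans (tClosure_le_vClosure _)
  have hJ : (toK K J).FG := (Submodule.FG.sup hF (Submodule.fg_span_singleton b)).map _
  have hJ0 : toK K J ≠ ⊥ := toK_ne_bot fun h0 =>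
    hb (Ideal.span_singleton_eq_bot.1 (sup_eq_bot_iff.1 h0).2 ▸ P.zero_mem)
  have hJb : J ≤ saturation M.primeCompl (Ideal.span {b}) :=
    sup_le (hFP.trans (hU.of_isFractionRing.le_saturation_span_of_isPrime
      (primeCompl_le_primeCompl hPM) hb)) (le_saturation _ _)
  calc vClosure (toK K P) ≤ vClosure (vClosure (toK K J)) := vClosure_mono hPJ
    _ = vClosure (toK K J) := vClosure_vClosure _
    _ ≤ saturation M.primeCompl (toK K J) :=
      hU.vClosure_le_saturation M.primeCompl_le_nonZeroDivisors hJ hJ0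
    _ ≤ saturation M.primeCompl (toK K (Ideal.span {b})) :=
      saturation_le_saturation (toK_le_saturation_iff.2 hJb)

theorem IsTPrime.isDivisorial (hD : IsPvMD D K) (hfc : HasFiniteTCharacter D K)
    (hP : IsTPrime K P) (hmax : ¬ IsTMaximal K P) : IsDivisorial K P := by
  refine isDivisorial_iff.2 fun d hd => ?_
  by_contra hdP
  obtain ⟨a, haP, ha⟩ := hP.exists_notMem_forall_isTMaximal hfc hmax
  obtain ⟨M, hM, hPM⟩ := hP.2.exists_le_isTMaximal hP.1.ne_top
  have := hM.isPrime
  have hdM : d ∈ saturation M.primeCompl (Ideal.span {a * d}) :=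
    (comap_saturation_toK _ _).le <|
      hP.vClosure_toK_le_saturation_span hD hfc hM.prop.2 hPM (hP.1.mul_notMem haP hdP) hd
  obtain ⟨s, hs, hsd⟩ := mem_saturation.1 hdM
  obtain ⟨r, hr⟩ := Ideal.mem_span_singleton.1 hsd
  have hd0 : d ≠ 0 := fun h0 => hdP (h0 ▸ P.zero_mem)
  have hsa : s = a * r := mul_right_cancel₀ hd0 (by rw [← smul_eq_mul s, hr]; ring)
  exact hs (hsa ▸ M.mul_mem_right r (ha M hM hPM))

end Divisorial

end StarOp

theorem mainTheorem11 (D K : Type*) [CommRing D] [IsDomain D] [Field K] [Algebra D K]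
    [IsFractionRing D K] (hD : StarOp.IsPvMD D K) (hfc : StarOp.HasFiniteTCharacter D K)
    (I : Ideal D) (hI0 : I ≠ ⊥) (hI : StarOp.IsTIdeal K I) :
    (StarOp.IsTIdempotent K I ↔
      ∃ s : Multiset (Ideal D),
        (∀ P ∈ s, StarOp.IsTPrime K P ∧ StarOp.IsTIdempotent K P) ∧
        StarOp.IsTProduct K I s) ∧
    List.TFAE [
      StarOp.IsTIdempotent K I ∧ StarOp.IsDivisorial K I,
      ∃ s : Multiset (Ideal D),
        (∀ P ∈ s, StarOp.IsTPrime K P ∧ StarOp.IsTIdempotent K P ∧ ¬ StarOp.IsTMaximal K P) ∧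
        StarOp.IsTProduct K I s,
      ∃ s : Multiset (Ideal D),
        (∀ P ∈ s, StarOp.IsTPrime K P ∧ StarOp.IsTIdempotent K P ∧ StarOp.IsDivisorial K P) ∧
        StarOp.IsTProduct K I s,
      ∃! s : Multiset (Ideal D),
        (∀ P ∈ s, StarOp.IsTPrime K P ∧ StarOp.IsTIdempotent K P ∧ StarOp.IsDivisorial K P) ∧
        StarOp.Incomparable s ∧
        StarOp.IsTProduct K I s] := by
  refine ⟨⟨fun h => ?_, fun ⟨s, hs, hIs⟩ => hIs.isTIdempotent hD hs⟩, ?_⟩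
  · obtain ⟨s, hs, -, hIs⟩ := h.exists_incomparable_isTProduct hD hfc hI
    exact ⟨s, hs, hIs⟩
  tfae_have 1 → 2 := by
    rintro ⟨hidem, hdiv⟩
    obtain ⟨s, hs, hinc, hIs⟩ := hidem.exists_incomparable_isTProduct hD hfc hI
    exact ⟨s, fun P hP => ⟨(hs P hP).1, (hs P hP).2,
      hdiv.not_isTMaximal_of_mem hD hs hinc hIs hP⟩, hIs⟩
  tfae_have 2 → 3 := fun ⟨s, hs, hIs⟩ => ⟨s, fun P hP =>
    have ⟨hPt, hPi, hPm⟩ := hs P hP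
    ⟨hPt, hPi, hPt.isDivisorial hD hfc hPm⟩, hIs⟩
  tfae_have 3 → 4 := by
    rintro ⟨u, hu, hIu⟩
    have hidem := hIu.isTIdempotent hD fun P hP => ⟨(hu P hP).1, (hu P hP).2.1⟩
    obtain ⟨s, hs, hinc, hIs⟩ := hidem.exists_incomparable_isTProduct hD hfc hI
    have hs' (P) (hP : P ∈ s) := (hs P hP).1
    refine ⟨s, ⟨fun P hP => hu P ?_, hinc, hIs⟩, fun w ⟨hw, hw_inc, hIw⟩ => ?_⟩
    · exact hIs.mem_of_mem_incomparable hs' (fun P hP => (hu P hP).1) hinc hIu hP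
    · exact hIw.eq_of_incomparable (fun P hP => (hw P hP).1) hs' hw_inc hinc hIs
  tfae_have 4 → 1 := by
    rintro ⟨s, ⟨hs, hinc, hIs⟩, -⟩
    refine ⟨hIs.isTIdempotent hD fun P hP => ⟨(hs P hP).1, (hs P hP).2.1⟩, ?_⟩
    rw [(hD.isTProduct_iff_eq_inf hinc fun P hP => (hs P hP).1).1 hIs]
    exact StarOp.IsDivisorial.multiset_inf fun P hP => (hs P hP).2.2
  tfae_finish
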